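/- **Corollary 6.1.** Let $m$ be a nonnegative integer and let $P$ be a complete separable metric space. Let $f:\mathbb{R}_{\ge 0}\times\mathbb{R}^m\times P\to\mathbb{R}^m$ and $f_0:\mathbb{R}_{\ge 0}\times\mathbb{R}^m\times P\to\mathbb{R}$ be continuous, and locally Lipschitz in $x$: each point $(t,x,u)$ has a neighbourhood in $\mathbb{R}_{\ge 0}\times\mathbb{R}^m\times P$ on which the function is Lipschitz in $x$ with a constant independent of the other two variables. Let $\mathbb{U}$ be the set of Lebesgue measurable functions $u:\mathbb{R}_{\ge 0}\to P$ that are bounded on every compact time interval, and let $f$ have sublinear growth: for every $u\in\mathbb{U}$ there is a locally integrable $l:\mathbb{R}_{\ge 0}\to\mathbb{R}$ such that, for almost all $t\ge 0$, $\|f(t,x,u(t))\|\le l(t)(1+\|x\|)$ for all $x\in\mathbb{R}^m$. Let $V:\mathbb{R}_{\ge 0}\times\mathbb{R}^m\to\mathbb{R}$ satisfy the dynamic programming principle: for all $0\le t\le\tau$ and $b\in\mathbb{R}^m$, $$V(t,b)=\inf_{u,x}\Big[\int_t^\tau f_0(s,x(s),u(s))\,ds+V(\tau,x(\tau))\Big],$$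 where the infimum is over $u\in\mathbb{U}$ and the corresponding motion $x$ on $[t,\tau]$, that is, the (Carathéodory) solution of $\dot x(s)=f(s,x(s),u(s))$, $x(t)=b$, for which the integral is defined and finite. Let $P'\subset P$ be compact and let $G$ be a (relatively) open subset of $\mathbb{R}_{\ge 0}\times\mathbb{R}^m$ with $$0\in \operatorname{int}\operatorname{conv}\{f(t,x,u):u\in P'\}\qquad\text{for all }(t,x)\in G.$$ Suppose that $$V(t,x)=R(t)\,S(x)\qquad\text{for all }(t,x)\in G,$$ where $S:\mathbb{R}^m\to\mathbb{R}$ is an arbitrary function and $R$ is a function of $t$ alone such that $(t,x)\mapsto R(t)$ is positive and locally Lipschitz on $G$. Then $V$ is locally Lipschitz (jointly in $(t,x)$) on $G$. -/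

import Mathlib

open MeasureTheory Set Topology
open scoped NNReal

namespace InfHorizon

variable {m : ℕ} {P : Type*} [MetricSpace P]

/-- Admissible controls: Lebesgue measurable functions `[0, ∞) → P` that are bounded on every
compact time interval. Values at negative times are irrelevant. -/
structure IsControl [MeasurableSpace P] (u : ℝ → P) : Prop where
  measurable : NullMeasurable u (volume.restrict (Ici (0 : ℝ)))
  bounded : ∀ T : ℝ, Bornology.IsBounded (u '' Icc 0 T)

/-- `g(t, x, u)`, `t ≥ 0`, is locally Lipschitz in `x`: every point `(t, x, u)` has a neighbourhood
on which `g` is Lipschitz in the second variable, uniformly in the other two. -/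
def LocLipschitzInState {F : Type*} [NormedAddCommGroup F]
    (g : ℝ → EuclideanSpace ℝ (Fin m) → P → F) : Prop :=
  ∀ (t : ℝ) (x : EuclideanSpace ℝ (Fin m)) (u : P), 0 ≤ t →
    ∃ L : ℝ≥0, ∃ N ∈ 𝓝 (t, x, u), ∀ (s : ℝ) (y z : EuclideanSpace ℝ (Fin m)) (v : P),
      0 ≤ s → (s, y, v) ∈ N → (s, z, v) ∈ N → ‖g s y v - g s z v‖ ≤ L * ‖y - z‖

/-- Sublinear growth of `f` in the state along every admissible control, with a locally
integrable coefficient. -/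
def SublinearGrowth [MeasurableSpace P]
    (f : ℝ → EuclideanSpace ℝ (Fin m) → P → EuclideanSpace ℝ (Fin m)) : Prop :=
  ∀ u : ℝ → P, IsControl u →
    ∃ l : ℝ → ℝ, LocallyIntegrableOn l (Ici 0) ∧
      ∀ᵐ s ∂(volume.restrict (Ici (0 : ℝ))),
        ∀ x : EuclideanSpace ℝ (Fin m), ‖f s x (u s)‖ ≤ l s * (1 + ‖x‖)

/-- `x` is the (Carathéodory) solution on `[t, τ]` of `x' = f(s, x, u(s))`, `x(t) = b`, written as
an integral equation with integrable right-hand side. -/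
structure IsSolution (f : ℝ → EuclideanSpace ℝ (Fin m) → P → EuclideanSpace ℝ (Fin m))
    (u : ℝ → P) (t τ : ℝ) (b : EuclideanSpace ℝ (Fin m))
    (x : ℝ → EuclideanSpace ℝ (Fin m)) : Prop where
  integrable : IntervalIntegrable (fun s => f s (x s) (u s)) volume t τ
  integral_eq : ∀ s ∈ Icc t τ, x s = b + ∫ r in t..s, f r (x r) (u r)

/-- The dynamic programming principle on `[0, ∞)` for a finite function `V`: for all `0 ≤ t ≤ τ`
and all `b`, the number `V(t, b)` is the infimum over admissible controls `u` of
`∫_t^τ f₀(s, x(s), u(s)) ds + V(τ, x(τ))`, where `x` is the motion of `u` starting at `(t, b)`. -/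
def SatisfiesDPP [MeasurableSpace P]
    (f : ℝ → EuclideanSpace ℝ (Fin m) → P → EuclideanSpace ℝ (Fin m))
    (f₀ : ℝ → EuclideanSpace ℝ (Fin m) → P → ℝ)
    (V : ℝ → EuclideanSpace ℝ (Fin m) → ℝ) : Prop :=
  ∀ (t τ : ℝ) (b : EuclideanSpace ℝ (Fin m)), 0 ≤ t → t ≤ τ →
    IsGLB {c : ℝ | ∃ (u : ℝ → P) (x : ℝ → EuclideanSpace ℝ (Fin m)),
        IsControl u ∧ IsSolution f u t τ b x ∧
        IntervalIntegrable (fun s => f₀ s (x s) (u s)) volume t τ ∧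
        c = (∫ s in t..τ, f₀ s (x s) (u s)) + V τ (x τ)}
      (V t b)

end InfHorizon

/-! Fix `(t₀, x₀)` in `G`. Since `0` is interior to the hull of the velocities, for every direction
some control in the compact set `P'` gives a velocity component of at least a fixed `r > 0` in that
direction, all over a neighbourhood (`exists_controllableTube`). Constant controls, re-aimed at `y`
after each step, shrink the distance to `y` geometrically, so nearby `b` and `y` are joined in time
at most `K‖y - b‖` (`ControllableTube.exists_steering`). Dynamic programming then gives `V(t₀, b) ≤
C(τ - t₀) + V(τ, y)` with `τ - t₀ ≤ K‖y - b‖`.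

The obstacle is the delay: the right side has `V` at time `τ`, and no regularity of `V` in time is
known. The product form removes it, because `R(τ)S(y)` differs from `R(t₀)S(y)` by at most `Λ(τ -
t₀)|S(y)|`. Taking `x₀` as one of the two points bounds `S` near `x₀`; arbitrary pairs then make `S`
Lipschitz there (`exists_lipschitz_of_delayed_bound`), and with it `V = RS`. -/

namespace InfHorizon

open Filter Metric

/-! ### Forward solutions and concatenation of countably many pieces. -/

section General

variable {E : Type*} [NormedAddCommGroup E]

/-- Picard-Lindelöf on a forward time interval, with the integral equation, the invariance of the
ball and the continuity of the velocity. -/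
theorem exists_integral_solution [NormedSpace ℝ E] [CompleteSpace E] {g : ℝ → E → E} {t h a M : ℝ} {L : ℝ≥0} {b : E}
    (hh : 0 ≤ h) (hM : 0 ≤ M) (ha : M * h ≤ a)
    (hlip : ∀ s ∈ Icc t (t + h), LipschitzOnWith L (g s) (closedBall b a))
    (hcont : ∀ x ∈ closedBall b a, ContinuousOn (fun s => g s x) (Icc t (t + h)))
    (hbd : ∀ s ∈ Icc t (t + h), ∀ x ∈ closedBall b a, ‖g s x‖ ≤ M) :
    ∃ x : ℝ → E, Continuous x ∧ (∀ s, x s ∈ closedBall b a) ∧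
      ContinuousOn (fun s => g s (x s)) (Icc t (t + h)) ∧
      ∀ s ∈ Icc t (t + h), x s = b + ∫ r in t..s, g r (x r) := by
  have ha0 : 0 ≤ a := (mul_nonneg hM hh).trans ha
  lift M to ℝ≥0 using hM
  lift a to ℝ≥0 using ha0
  have hPL : IsPicardLindelof g (⟨t, by simp [hh]⟩ : Icc t (t + h)) b a 0 M L :=
    { lipschitzOnWith := hlip
      continuousOn := hcont
      norm_le := hbd
      mul_max_le := by simpa [hh] using ha }
  have hb : b ∈ closedBall b ((0 : ℝ≥0) : ℝ) := by simp
  obtain ⟨α, hα⟩ := ODE.FunSpace.exists_isFixedPt_next hPL hb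
  -- `compProj` extends the fixed point by constants outside the interval, so continuity and the
  -- ball constraint hold at all times.
  refine ⟨α.compProj, α.continuous_compProj,
    fun s => α.compProj_mem_closedBall hPL.mul_max_le, α.continuousOn_comp_compProj hPL,
    fun s hs => ?_⟩
  conv_lhs => rw [← hα]
  rw [ODE.FunSpace.compProj_of_mem hs, ODE.FunSpace.next_apply, ODE.picard_apply]

theorem iUnion_Ico_eq_of_tendsto {t : ℕ → ℝ} {τ : ℝ} (ht : Monotone t)
    (hτ : Tendsto t atTop (𝓝 τ)) : ⋃ n, Ico (t n) (t (n + 1)) = Ico (t 0) τ := by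
  ext s
  simp only [mem_iUnion, mem_Ico]
  constructor
  · rintro ⟨n, h1, h2⟩
    exact ⟨(ht (Nat.zero_le n)).trans h1, h2.trans_le (ht.ge_of_tendsto hτ _)⟩
  · rintro ⟨h1, h2⟩
    have hex : ∃ n, s < t n := (hτ.eventually (lt_mem_nhds h2)).exists
    classical
    obtain ⟨k, hk⟩ : ∃ k, Nat.find hex = k + 1 := by
      refine Nat.exists_eq_succ_of_ne_zero fun h0 => ?_
      have := Nat.find_spec hex
      rw [h0] at this
      exact absurd this (not_lt.2 h1)
    refine ⟨k, not_lt.1 (Nat.find_min hex (by omega)), ?_⟩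
    have := Nat.find_spec hex
    rwa [hk] at this

/-- Switching times may accumulate at `τ`. Measurability survives the countable union of pieces, and
the bound gives integrability on an interval of finite length. -/
theorem intervalIntegrable_of_continuousOn_pieces {φ : ℝ → E} {t : ℕ → ℝ} {τ C : ℝ}
    (ht : Monotone t) (hτ : Tendsto t atTop (𝓝 τ))
    (hφ : ∀ n, ContinuousOn φ (Ico (t n) (t (n + 1))))
    (hC : ∀ s ∈ Ico (t 0) τ, ‖φ s‖ ≤ C) : IntervalIntegrable φ volume (t 0) τ := by
  have hle : t 0 ≤ τ := ht.ge_of_tendsto hτ 0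
  rw [intervalIntegrable_iff_integrableOn_Ico_of_le hle]
  refine Integrable.of_bound ?_ C
    ((ae_restrict_iff' measurableSet_Ico).2 (Eventually.of_forall hC))
  rw [← iUnion_Ico_eq_of_tendsto ht hτ]
  exact AEStronglyMeasurable.iUnion fun n => (hφ n).aestronglyMeasurable measurableSet_Ico

/-- The number of the interval `[t n, t (n + 1))` that contains `s`, and `0` if there is none. -/
noncomputable def pieceIndex (t : ℕ → ℝ) (s : ℝ) : ℕ := sInf {n | s < t (n + 1)}

theorem pieceIndex_eq {t : ℕ → ℝ} (ht : Monotone t) {n : ℕ} {s : ℝ}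
    (hs : s ∈ Ico (t n) (t (n + 1))) : pieceIndex t s = n := by
  refine le_antisymm (Nat.sInf_le hs.2) (le_csInf ⟨n, hs.2⟩ fun j hj => ?_)
  by_contra! hlt
  exact absurd (hs.1.trans_lt hj) (not_lt.2 (ht hlt))

theorem measurable_pieceIndex {t : ℕ → ℝ} {τ : ℝ} (ht : Monotone t)
    (hτ : Tendsto t atTop (𝓝 τ)) : Measurable (pieceIndex t) := by
  refine measurable_of_Iic fun n => ?_
  -- From `τ` on the defining set is empty and `sInf ∅ = 0`, so `Ici τ` lies in every sublevel set.
  have : pieceIndex t ⁻¹' Iic n = Iio (t (n + 1)) ∪ Ici τ := by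
    ext s
    simp only [mem_preimage, mem_Iic, mem_union, mem_Iio, mem_Ici]
    constructor
    · intro h
      by_contra! hs
      obtain ⟨j, hj⟩ := (hτ.eventually (lt_mem_nhds hs.2)).exists
      have hne : {n | s < t (n + 1)}.Nonempty := ⟨j, hj.trans_le (ht (Nat.le_succ j))⟩
      have h1 : s < t (pieceIndex t s + 1) := Nat.sInf_mem hne
      exact absurd (h1.trans_le (ht (Nat.succ_le_succ h))) (not_lt.2 hs.1)
    · rintro (h | h)
      · exact Nat.sInf_le h
      · have : {n | s < t (n + 1)} = ∅ := by
          ext j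
          simpa using (ht.ge_of_tendsto hτ _).trans h
        simp [pieceIndex, this]
  rw [this]
  exact measurableSet_Iio.union measurableSet_Ici

end General

variable {m : ℕ} {P : Type*}

/-- Solutions for constant controls on consecutive intervals `[t n, t (n + 1)]` whose initial
values converge to `y` join to a solution on `[t 0, lim t]` that ends in `y`. -/
theorem isSolution_concat
    {f : ℝ → EuclideanSpace ℝ (Fin m) → P → EuclideanSpace ℝ (Fin m)}
    {t : ℕ → ℝ} {τ M : ℝ} {U : ℕ → P} {b : ℕ → EuclideanSpace ℝ (Fin m)}
    {X : ℕ → ℝ → EuclideanSpace ℝ (Fin m)} {y : EuclideanSpace ℝ (Fin m)}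
    (ht : Monotone t) (hτ : Tendsto t atTop (𝓝 τ)) (hb : Tendsto b atTop (𝓝 y))
    (hcont : ∀ n, ContinuousOn (fun s => f s (X n s) (U n)) (Icc (t n) (t (n + 1))))
    (hM : ∀ n, ∀ s ∈ Icc (t n) (t (n + 1)), ‖f s (X n s) (U n)‖ ≤ M)
    (hX : ∀ n, ∀ s ∈ Icc (t n) (t (n + 1)), X n s = b n + ∫ r in t n..s, f r (X n r) (U n))
    (hstep : ∀ n, b (n + 1) = X n (t (n + 1))) :
    ∃ x : ℝ → EuclideanSpace ℝ (Fin m), x τ = y ∧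
      (∀ n, ∀ s ∈ Ico (t n) (t (n + 1)), x s = X n s) ∧
      IsSolution f (fun s => U (pieceIndex t s)) (t 0) τ (b 0) x := by
  have hmem : ∀ {n s}, s ∈ Ico (t n) (t (n + 1)) → s < τ := fun {n s} hs =>
    hs.2.trans_le (ht.ge_of_tendsto hτ _)
  let x : ℝ → EuclideanSpace ℝ (Fin m) := fun s => if s < τ then X (pieceIndex t s) s else y
  have hx : ∀ n, ∀ s ∈ Ico (t n) (t (n + 1)), x s = X n s := fun n s hs => by
    simp [x, hmem hs, pieceIndex_eq ht hs]
  have hxτ : x τ = y := by simp [x]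
  let φ : ℝ → EuclideanSpace ℝ (Fin m) := fun s => f s (x s) (U (pieceIndex t s))
  have hφ : ∀ n, ∀ s ∈ Ico (t n) (t (n + 1)), φ s = f s (X n s) (U n) := fun n s hs => by
    simp only [φ, hx n s hs, pieceIndex_eq ht hs]
  have hcover := iUnion_Ico_eq_of_tendsto ht hτ
  have hint : IntervalIntegrable φ volume (t 0) τ := by
    refine intervalIntegrable_of_continuousOn_pieces (C := M) ht hτ
      (fun n => ((hcont n).mono Ico_subset_Icc_self).congr (hφ n)) fun s hs => ?_
    rw [← hcover] at hs
    obtain ⟨n, hn⟩ := mem_iUnion.1 hs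
    rw [hφ n s hn]
    exact hM n s (Ico_subset_Icc_self hn)
  have hsub : ∀ {p q}, p ∈ Icc (t 0) τ → q ∈ Icc (t 0) τ → IntervalIntegrable φ volume p q :=
    fun {p q} hp hq => hint.mono_set (by
      rw [uIcc_of_le (hp.1.trans hp.2)]
      exact uIcc_subset_Icc hp hq)
  have htm : ∀ n, t n ∈ Icc (t 0) τ := fun n => ⟨ht (Nat.zero_le n), ht.ge_of_tendsto hτ n⟩
  have h0 : t 0 ∈ Icc (t 0) τ := htm 0
  have hXφ : ∀ n, ∀ s ∈ Icc (t n) (t (n + 1)), X n s = b n + ∫ r in t n..s, φ r := by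
    intro n s hs
    rw [hX n s hs]
    congr 1
    -- The endpoint `t (n + 1)` belongs to the next piece; the integral does not see it.
    refine intervalIntegral.integral_congr_Ioo_of_le hs.1 fun r hr => (hφ n r ?_).symm
    exact ⟨hr.1.le, hr.2.trans_le hs.2⟩
  have hbn : ∀ n, b n = b 0 + ∫ r in t 0..t n, φ r := by
    intro n
    induction n with
    | zero => simp
    | succ n ih =>
      rw [hstep n, hXφ n _ ⟨ht (Nat.le_succ n), le_rfl⟩, ih, add_assoc,
        intervalIntegral.integral_add_adjacent_intervals (hsub h0 (htm n))
          (hsub (htm n) (htm (n + 1)))]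
  refine ⟨x, hxτ, hx, hint, fun s hs => ?_⟩
  change x s = b 0 + ∫ r in t 0..s, φ r
  rcases hs.2.lt_or_eq with hlt | rfl
  · have hs' : s ∈ ⋃ n, Ico (t n) (t (n + 1)) := by rw [hcover]; exact ⟨hs.1, hlt⟩
    obtain ⟨n, hn⟩ := mem_iUnion.1 hs'
    rw [hx n s hn, hXφ n s (Ico_subset_Icc_self hn), hbn n, add_assoc,
      intervalIntegral.integral_add_adjacent_intervals (hsub h0 (htm n)) (hsub (htm n) hs)]
  -- No piece contains `τ`: the equation there is the limit of the equations at `t n`, by continuity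
  -- of the primitive.
  · rw [hxτ]
    refine tendsto_nhds_unique hb ?_
    refine Tendsto.congr (fun n => (hbn n).symm) (tendsto_const_nhds.add ?_)
    have hc : ContinuousWithinAt (fun p => ∫ r in t 0..p, φ r) (Icc (t 0) s) s := by
      have := intervalIntegral.continuousOn_primitive_interval' hint left_mem_uIcc
      rw [uIcc_of_le hs.1] at this
      exact this s hs
    exact hc.tendsto.comp
      (tendsto_nhdsWithin_iff.2 ⟨hτ, Eventually.of_forall htm⟩)

end InfHorizon

/-! ### Steering between nearby points. -/

namespace InfHorizon

open Filter Metric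

variable {m : ℕ} {P : Type*}

/-- On the cylinder `[t₀, t₀ + δ] × closedBall x₀ δ` the velocities for the controls in `P'` are
continuous, bounded by `M`, `L`-Lipschitz in the state, and for every direction some control gives
at least the speed `r` in that direction all over the cylinder. -/
structure ControllableTube (f : ℝ → EuclideanSpace ℝ (Fin m) → P → EuclideanSpace ℝ (Fin m))
    (P' : Set P) (t₀ : ℝ) (x₀ : EuclideanSpace ℝ (Fin m)) (δ M r : ℝ) (L : ℝ≥0) : Prop where
  continuousOn : ∀ u ∈ P', ContinuousOn
    (fun p : ℝ × EuclideanSpace ℝ (Fin m) => f p.1 p.2 u) (Icc t₀ (t₀ + δ) ×ˢ closedBall x₀ δ)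
  norm_le : ∀ u ∈ P', ∀ s ∈ Icc t₀ (t₀ + δ), ∀ x ∈ closedBall x₀ δ, ‖f s x u‖ ≤ M
  lipschitz : ∀ u ∈ P', ∀ s ∈ Icc t₀ (t₀ + δ),
    LipschitzOnWith L (fun x => f s x u) (closedBall x₀ δ)
  direction : ∀ d : EuclideanSpace ℝ (Fin m), ∃ u ∈ P', ∀ s ∈ Icc t₀ (t₀ + δ),
    ∀ x ∈ closedBall x₀ δ, r * ‖d‖ ≤ inner ℝ d (f s x u)

variable {f : ℝ → EuclideanSpace ℝ (Fin m) → P → EuclideanSpace ℝ (Fin m)}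
  {P' : Set P} {t₀ δ M r : ℝ} {L : ℝ≥0} {x₀ : EuclideanSpace ℝ (Fin m)}

/-- With a constant control the distance to `y` shrinks by a fixed factor within a time
proportional to it. -/
theorem ControllableTube.exists_step (hT : ControllableTube f P' t₀ x₀ δ M r L)
    (hr : 0 < r) (hrM : r ≤ M) {t : ℝ} {x y : EuclideanSpace ℝ (Fin m)} (ht : t₀ ≤ t)
    (htδ : t + r / M ^ 2 * ‖y - x‖ ≤ t₀ + δ) (hx : ‖x - x₀‖ + ‖y - x‖ ≤ δ) :
    ∃ u ∈ P', ∃ X : ℝ → EuclideanSpace ℝ (Fin m), Continuous X ∧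
      (∀ s, X s ∈ closedBall x₀ δ) ∧
      (∀ s ∈ Icc t (t + r / M ^ 2 * ‖y - x‖), X s = x + ∫ p in t..s, f p (X p) u) ∧
      ‖y - X (t + r / M ^ 2 * ‖y - x‖)‖ ≤ √(1 - r ^ 2 / M ^ 2) * ‖y - x‖ := by
  have hM : 0 < M := hr.trans_le hrM
  obtain ⟨u, hu, hdir⟩ := hT.direction (y - x)
  -- With `d = y - x`, this `h` minimises the bound `‖d‖² - 2hr‖d‖ + M²h²` for the squared final
  -- distance; the minimum is `(1 - r²/M²)‖d‖²`.
  set h := r / M ^ 2 * ‖y - x‖ with hh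
  have hh0 : 0 ≤ h := by positivity
  have hball : closedBall x ‖y - x‖ ⊆ closedBall x₀ δ :=
    closedBall_subset_closedBall' (by rw [dist_eq_norm]; linarith)
  have hIcc : Icc t (t + h) ⊆ Icc t₀ (t₀ + δ) := Icc_subset_Icc ht htδ
  have hMh : M * h ≤ ‖y - x‖ := by
    have : M * h = r / M * ‖y - x‖ := by rw [hh]; field_simp
    rw [this]
    exact mul_le_of_le_one_left (norm_nonneg _) ((div_le_one hM).2 hrM)
  obtain ⟨X, hXc, hXb, hXf, hXi⟩ := exists_integral_solution (g := fun s z => f s z u) (L := L)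
    hh0 hM.le hMh (fun s hs => (hT.lipschitz u hu s (hIcc hs)).mono hball)
    (fun z hz => (hT.continuousOn u hu).comp (f := fun s : ℝ => (s, z)) (by fun_prop)
      fun s hs => ⟨hIcc hs, hball hz⟩)
    fun s hs z hz => hT.norm_le u hu s (hIcc hs) z (hball hz)
  refine ⟨u, hu, X, hXc, fun s => hball (hXb s), hXi, ?_⟩
  have hle : t ≤ t + h := by linarith
  have hint : IntervalIntegrable (fun p => f p (X p) u) volume t (t + h) :=
    ContinuousOn.intervalIntegrable (by rwa [uIcc_of_le hle])
  set D := ∫ p in t..t + h, f p (X p) u with hD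
  have hDM : ‖D‖ ≤ M * h := by
    refine (intervalIntegral.norm_integral_le_of_norm_le_const (C := M) fun p hp => ?_).trans ?_
    · rw [uIoc_of_le hle] at hp
      exact hT.norm_le u hu p (hIcc (Ioc_subset_Icc_self hp)) _ (hball (hXb p))
    · simp [abs_of_nonneg hh0]
  have hDd : h * (r * ‖y - x‖) ≤ inner ℝ (y - x) D := by
    have h1 : inner ℝ (y - x) D = ∫ p in t..t + h, inner ℝ (y - x) (f p (X p) u) :=
      ((innerSL ℝ (y - x)).intervalIntegral_comp_comm hint).symm
    have h2 : h * (r * ‖y - x‖) = ∫ _ in t..t + h, r * ‖y - x‖ := by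
      simp [mul_left_comm]
    rw [h1, h2]
    refine intervalIntegral.integral_mono_on hle (by simp) ?_ fun p hp =>
      hdir p (hIcc hp) _ (hball (hXb p))
    exact ContinuousOn.intervalIntegrable (by
      rw [uIcc_of_le hle]; exact continuousOn_const.inner hXf)
  have hend : y - X (t + h) = (y - x) - D := by
    rw [hXi _ ⟨hle, le_rfl⟩]; abel
  rw [hend, ← Real.sqrt_sq (norm_nonneg (y - x)), ← Real.sqrt_mul' _ (sq_nonneg _)]
  refine Real.le_sqrt_of_sq_le ?_
  rw [norm_sub_sq_real]
  have hD2 : ‖D‖ ^ 2 ≤ (M * h) ^ 2 := by gcongr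
  have e1 : (M * h) ^ 2 = r ^ 2 / M ^ 2 * ‖y - x‖ ^ 2 := by rw [hh]; field_simp
  have e2 : h * (r * ‖y - x‖) = r ^ 2 / M ^ 2 * ‖y - x‖ ^ 2 := by rw [hh]; field_simp
  nlinarith

/-- Near the centre of the cylinder any two points are joined by a motion in the cylinder, with
controls in `P'`, in a time at most proportional to their distance. -/
theorem ControllableTube.exists_steering (hT : ControllableTube f P' t₀ x₀ δ M r L) (hδ : 0 < δ)
    (hr : 0 < r) (hrM : r ≤ M) :
    ∃ K > 0, ∃ ρ > 0, ∀ b ∈ closedBall x₀ ρ, ∀ y ∈ closedBall x₀ ρ,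
      ∃ (τ : ℝ) (u : ℝ → P) (x : ℝ → EuclideanSpace ℝ (Fin m)), t₀ ≤ τ ∧ τ ≤ t₀ + K * ‖y - b‖ ∧
        τ ≤ t₀ + δ ∧ (∀ [MeasurableSpace P], Measurable u) ∧ (∀ s, u s ∈ P') ∧
        IsSolution f u t₀ τ b x ∧ x τ = y ∧ (∀ s ∈ Icc t₀ τ, x s ∈ closedBall x₀ δ) ∧
        ∀ (g : ℝ → EuclideanSpace ℝ (Fin m) → P → ℝ) (C : ℝ),
          (∀ v ∈ P', ContinuousOn (fun p : ℝ × EuclideanSpace ℝ (Fin m) => g p.1 p.2 v)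
            (Icc t₀ (t₀ + δ) ×ˢ closedBall x₀ δ)) →
          (∀ v ∈ P', ∀ s ∈ Icc t₀ (t₀ + δ), ∀ z ∈ closedBall x₀ δ, ‖g s z v‖ ≤ C) →
          IntervalIntegrable (fun s => g s (x s) (u s)) volume t₀ τ := by
  have hM : 0 < M := hr.trans_le hrM
  set q := √(1 - r ^ 2 / M ^ 2) with hq
  have hq0 : 0 ≤ q := Real.sqrt_nonneg _
  have hq1 : q < 1 := by
    rw [hq, Real.sqrt_lt' one_pos]
    have : 0 < r ^ 2 / M ^ 2 := by positivity
    linarith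
  set c := r / M ^ 2 with hc
  have hc0 : 0 < c := by positivity
  -- The sum of the step times `c qⁿ`, per unit of initial distance.
  set K := c / (1 - q) with hK
  have hK0 : 0 < K := div_pos hc0 (by linarith)
  have hcK : c + K * q = K := by
    have : 1 - q ≠ 0 := by linarith
    rw [hK]; field_simp; ring
  -- Iterates stay within `2ρ` of `y`, hence `3ρ` of `x₀`, so `exists_step` needs `3ρ + 2ρ ≤ δ`. The
  -- total time is at most `K · 2ρ ≤ δ`.
  refine ⟨K, hK0, min (δ / 5) (δ / (2 * K)), by positivity, fun b hb y hy => ?_⟩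
  set ρ := min (δ / 5) (δ / (2 * K)) with hρ
  have hρ5 : 5 * ρ ≤ δ := by have := min_le_left (δ / 5) (δ / (2 * K)); linarith
  have hρK : K * (2 * ρ) ≤ δ := by
    have h1 : ρ ≤ δ / (2 * K) := min_le_right _ _
    rw [le_div_iff₀ (by positivity)] at h1
    linarith
  rw [mem_closedBall, dist_eq_norm] at hb hy
  have hby : ‖y - b‖ ≤ 2 * ρ := by
    have := norm_sub_le_norm_sub_add_norm_sub y x₀ b
    rw [norm_sub_rev x₀ b] at this
    linarith
  have hTδ : t₀ + K * ‖y - b‖ ≤ t₀ + δ := by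
    have := mul_le_mul_of_nonneg_left hby hK0.le
    linarith
  -- The potential `time + K · distance` does not increase along a step, because `c + K q = K`. It
  -- bounds all switching times at once.
  let Inv : ℝ × EuclideanSpace ℝ (Fin m) → Prop := fun p =>
    t₀ ≤ p.1 ∧ p.1 + K * ‖y - p.2‖ ≤ t₀ + K * ‖y - b‖ ∧ ‖y - p.2‖ ≤ 2 * ρ
  have hstep : ∀ p : {p // Inv p}, ∃ u ∈ P', ∃ X : ℝ → EuclideanSpace ℝ (Fin m), Continuous X ∧
      (∀ s, X s ∈ closedBall x₀ δ) ∧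
      (∀ s ∈ Icc p.1.1 (p.1.1 + c * ‖y - p.1.2‖),
        X s = p.1.2 + ∫ a in p.1.1..s, f a (X a) u) ∧
      ‖y - X (p.1.1 + c * ‖y - p.1.2‖)‖ ≤ q * ‖y - p.1.2‖ := by
    rintro ⟨⟨t, x⟩, h1, h2, h3⟩
    simp only at h1 h2 h3
    refine hT.exists_step hr hrM h1 ?_ ?_
    · have : c * ‖y - x‖ ≤ K * ‖y - x‖ :=
        mul_le_mul_of_nonneg_right (by nlinarith) (norm_nonneg _)
      linarith
    · have := norm_sub_le_norm_sub_add_norm_sub x y x₀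
      rw [norm_sub_rev x y] at this
      linarith
  choose U hU X hXc hXb hXi hXq using hstep
  let next : {p // Inv p} → {p // Inv p} := fun p =>
    ⟨(p.1.1 + c * ‖y - p.1.2‖, X p (p.1.1 + c * ‖y - p.1.2‖)), by
      obtain ⟨h1, h2, h3⟩ := p.2
      refine ⟨?_, ?_, ?_⟩
      · have := mul_nonneg hc0.le (norm_nonneg (y - p.1.2))
        simp only
        linarith
      · have := mul_le_mul_of_nonneg_left (hXq p) hK0.le
        simp only
        have e : (c + K * q) * ‖y - p.1.2‖ = K * ‖y - p.1.2‖ := by rw [hcK]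
        linarith
      · exact (hXq p).trans ((mul_le_of_le_one_left (norm_nonneg _) hq1.le).trans h3)⟩
  let z : ℕ → {p // Inv p} := fun n => next^[n] ⟨(t₀, b), le_rfl, le_rfl, hby⟩
  have hz : ∀ n, z (n + 1) = next (z n) := fun n => Function.iterate_succ_apply' _ _ _
  let t : ℕ → ℝ := fun n => (z n).1.1
  let β : ℕ → EuclideanSpace ℝ (Fin m) := fun n => (z n).1.2
  have ht : ∀ n, t (n + 1) = t n + c * ‖y - β n‖ := fun n => by simp only [t, hz]; rfl
  have hβ : ∀ n, β (n + 1) = X (z n) (t (n + 1)) := fun n => by simp only [β, t, hz]; rfl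
  have hmono : Monotone t := monotone_nat_of_le_succ fun n => by
    rw [ht]
    exact le_add_of_nonneg_right (by positivity)
  have htK : ∀ n, t n ≤ t₀ + K * ‖y - b‖ := fun n =>
    (le_add_of_nonneg_right (by positivity)).trans (z n).2.2.1
  obtain ⟨τ, hτ⟩ : ∃ τ, Tendsto t atTop (𝓝 τ) :=
    ⟨_, tendsto_atTop_ciSup hmono ⟨_, forall_mem_range.2 htK⟩⟩
  have hτK : τ ≤ t₀ + K * ‖y - b‖ := le_of_tendsto' hτ htK
  have hτδ : τ ≤ t₀ + δ := hτK.trans hTδ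
  have hgeom : ∀ n, ‖y - β n‖ ≤ q ^ n * ‖y - b‖ := by
    intro n
    induction n with
    | zero => simp [β, z]
    | succ n ih =>
      rw [hβ, ht, pow_succ']
      refine (hXq (z n)).trans ?_
      rw [mul_assoc]
      exact mul_le_mul_of_nonneg_left ih hq0
  have hβy : Tendsto β atTop (𝓝 y) := by
    rw [tendsto_iff_norm_sub_tendsto_zero]
    refine squeeze_zero (fun _ => norm_nonneg _)
      (fun n => (norm_sub_rev (β n) y).trans_le (hgeom n)) ?_
    simpa using (tendsto_pow_atTop_nhds_zero_of_lt_one hq0 hq1).mul_const ‖y - b‖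
  have hpiece : ∀ n, Icc (t n) (t (n + 1)) ⊆ Icc t₀ (t₀ + δ) := fun n =>
    Icc_subset_Icc (z n).2.1 ((htK _).trans hTδ)
  have hcomp : ∀ {F : Type} [TopologicalSpace F] (g : ℝ → EuclideanSpace ℝ (Fin m) → P → F),
      (∀ v ∈ P', ContinuousOn (fun p : ℝ × EuclideanSpace ℝ (Fin m) => g p.1 p.2 v)
        (Icc t₀ (t₀ + δ) ×ˢ closedBall x₀ δ)) →
      ∀ n, ContinuousOn (fun s => g s (X (z n) s) (U (z n))) (Icc (t n) (t (n + 1))) :=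
    fun g hg n => (hg _ (hU (z n))).comp (f := fun s => (s, X (z n) s))
      (continuousOn_id.prodMk (hXc (z n)).continuousOn) fun s hs => ⟨hpiece n hs, hXb (z n) s⟩
  obtain ⟨x, hxτ, hxX, hsol⟩ := isSolution_concat (f := f) (M := M) (U := fun n => U (z n))
    (b := β) (X := fun n => X (z n)) hmono hτ hβy (hcomp f hT.continuousOn)
    (fun n s hs => hT.norm_le _ (hU _) s (hpiece n hs) _ (hXb _ s))
    (fun n s hs => hXi (z n) s (by rwa [ht] at hs)) hβ
  have hcover : ∀ s ∈ Ico t₀ τ, ∃ n, s ∈ Ico (t n) (t (n + 1)) := fun s hs => by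
    have : s ∈ ⋃ n, Ico (t n) (t (n + 1)) := by rwa [iUnion_Ico_eq_of_tendsto hmono hτ]
    exact mem_iUnion.1 this
  have hρδ : ρ ≤ δ := by
    have := (norm_nonneg (y - x₀)).trans hy
    linarith
  -- The control factors through the discrete space `ℕ`, so it is measurable for any σ-algebra on
  -- `P`.
  refine ⟨τ, _, x, hmono.ge_of_tendsto hτ 0, hτK, hτδ, fun {_} =>
    (measurable_of_countable fun n => U (z n)).comp (measurable_pieceIndex hmono hτ),
    fun s => hU _, hsol, hxτ, fun s hs => ?_, fun g C hg hC => ?_⟩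
  · rcases hs.2.lt_or_eq with hlt | rfl
    · obtain ⟨n, hn⟩ := hcover s ⟨hs.1, hlt⟩
      rw [hxX n s hn]
      exact hXb _ s
    · rw [hxτ, mem_closedBall, dist_eq_norm]
      exact hy.trans hρδ
  · refine intervalIntegrable_of_continuousOn_pieces (C := C) hmono hτ
      (fun n => ((hcomp g hg n).mono Ico_subset_Icc_self).congr fun s hs => ?_) fun s hs => ?_
    · simp only [hxX n s hs, Function.comp_apply, pieceIndex_eq hmono hs]
    · obtain ⟨n, hn⟩ := hcover s hs
      simp only [hxX n s hn]
      exact hC _ (hU _) s (hpiece n (Ico_subset_Icc_self hn)) _ (hXb _ s)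

end InfHorizon

/-! ### Local controllability from the convex hull condition. -/

namespace InfHorizon

open Filter Metric

/-- If a ball around `0` lies in the convex hull of `A`, then in each direction some point of `A`
is at least as far as the radius. -/
theorem exists_mem_mul_norm_le_inner {E : Type*} [NormedAddCommGroup E] [InnerProductSpace ℝ E]
    {A : Set E} {r : ℝ} (hr : 0 ≤ r) (hA : closedBall 0 r ⊆ convexHull ℝ A) (d : E) :
    ∃ v ∈ A, r * ‖d‖ ≤ inner ℝ d v := by
  by_contra! hlt
  have hsub : convexHull ℝ A ⊆ {v | inner ℝ d v < r * ‖d‖} :=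
    convexHull_min hlt (convex_halfSpace_lt (innerSL ℝ d).isLinear _)
  -- For `d = 0` the test vector is `0` by the convention `r / 0 = 0`, and the strict half-space is
  -- empty.
  have hmem : (r / ‖d‖) • d ∈ closedBall (0 : E) r := by
    rcases eq_or_ne d 0 with rfl | hd
    · simpa using hr
    · rw [mem_closedBall_zero_iff, norm_smul, norm_div, norm_norm,
        div_mul_cancel₀ _ (norm_ne_zero_iff.2 hd), Real.norm_of_nonneg hr]
  have := hsub (hA hmem)
  rcases eq_or_ne d 0 with rfl | hd
  · simp at this
  · have hd' : ‖d‖ ≠ 0 := norm_ne_zero_iff.2 hd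
    simp only [mem_ofPred_eq, inner_smul_right, real_inner_self_eq_norm_sq] at this
    have e : r / ‖d‖ * ‖d‖ ^ 2 = r * ‖d‖ := by field_simp
    exact absurd this (by rw [e]; exact lt_irrefl _)

variable {m : ℕ} {P : Type*} [MetricSpace P] {F : Type*} [NormedAddCommGroup F]
  {g : ℝ → EuclideanSpace ℝ (Fin m) → P → F} {P' : Set P} {t₀ : ℝ}
  {x₀ : EuclideanSpace ℝ (Fin m)}

/-- Continuity at `(t₀, x₀, u)` gives a `δ` valid for all controls near `u`; compactness of `P'`
leaves finitely many `δ` to minimise. -/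
theorem exists_uniform_close
    (hg : ContinuousOn (fun p : ℝ × EuclideanSpace ℝ (Fin m) × P => g p.1 p.2.1 p.2.2)
      {p | 0 ≤ p.1}) (hP' : IsCompact P') (ht₀ : 0 ≤ t₀) {ε : ℝ} (hε : 0 < ε) :
    ∃ δ > 0, ∀ u ∈ P', ∀ s ∈ Icc t₀ (t₀ + δ), ∀ x ∈ closedBall x₀ δ,
      ‖g s x u - g t₀ x₀ u‖ ≤ ε := by
  refine hP'.induction_on (p := fun K => ∃ δ > 0, ∀ u ∈ K, ∀ s ∈ Icc t₀ (t₀ + δ),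
    ∀ x ∈ closedBall x₀ δ, ‖g s x u - g t₀ x₀ u‖ ≤ ε) ⟨1, one_pos, by simp⟩ ?_ ?_ ?_
  · rintro A B hAB ⟨δ, hδ, h⟩
    exact ⟨δ, hδ, fun u hu => h u (hAB hu)⟩
  · rintro A B ⟨δ, hδ, h⟩ ⟨δ', hδ', h'⟩
    refine ⟨min δ δ', lt_min hδ hδ', fun u hu s hs x hx => ?_⟩
    rcases hu with hu | hu
    · exact h u hu s ⟨hs.1, hs.2.trans (by gcongr; exact min_le_left _ _)⟩ x
        (closedBall_subset_closedBall (min_le_left _ _) hx)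
    · exact h' u hu s ⟨hs.1, hs.2.trans (by gcongr; exact min_le_right _ _)⟩ x
        (closedBall_subset_closedBall (min_le_right _ _) hx)
  · intro u _
    obtain ⟨δ, hδ, h⟩ := Metric.continuousWithinAt_iff.1 (hg (t₀, x₀, u) ht₀) (ε / 2) (half_pos hε)
    refine ⟨ball u δ, mem_nhdsWithin_of_mem_nhds (ball_mem_nhds u hδ), δ / 2, half_pos hδ,
      fun v hv s hs x hx => ?_⟩
    have hs' : dist s t₀ < δ := by
      rw [Real.dist_eq, abs_of_nonneg (sub_nonneg.2 hs.1)]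
      linarith [hs.2]
    have hx' : dist x x₀ < δ := (mem_closedBall.1 hx).trans_lt (by linarith)
    have h1 := @h (s, x, v) (ht₀.trans hs.1) (by simp [Prod.dist_eq, hs', hx', mem_ball.1 hv])
    have h2 := @h (t₀, x₀, v) ht₀ (by simp [Prod.dist_eq, mem_ball.1 hv])
    rw [← dist_eq_norm]
    refine (dist_triangle_right _ _ (g t₀ x₀ u)).trans ?_
    exact (add_le_add h1.le h2.le).trans (by linarith)

theorem exists_uniform_lipschitz (hg : LocLipschitzInState g) (hP' : IsCompact P')
    (ht₀ : 0 ≤ t₀) :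
    ∃ δ > 0, ∃ L : ℝ≥0, ∀ u ∈ P', ∀ s ∈ Icc t₀ (t₀ + δ),
      LipschitzOnWith L (fun x => g s x u) (closedBall x₀ δ) := by
  refine hP'.induction_on (p := fun K => ∃ δ > 0, ∃ L : ℝ≥0, ∀ u ∈ K, ∀ s ∈ Icc t₀ (t₀ + δ),
    LipschitzOnWith L (fun x => g s x u) (closedBall x₀ δ)) ⟨1, one_pos, 0, by simp⟩ ?_ ?_ ?_
  · rintro A B hAB ⟨δ, hδ, L, h⟩
    exact ⟨δ, hδ, L, fun u hu => h u (hAB hu)⟩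
  · rintro A B ⟨δ, hδ, L, h⟩ ⟨δ', hδ', L', h'⟩
    refine ⟨min δ δ', lt_min hδ hδ', max L L', fun u hu s hs => ?_⟩
    rcases hu with hu | hu
    · exact ((h u hu s ⟨hs.1, hs.2.trans (by gcongr; exact min_le_left _ _)⟩).mono
        (closedBall_subset_closedBall (min_le_left _ _))).weaken (le_max_left _ _)
    · exact ((h' u hu s ⟨hs.1, hs.2.trans (by gcongr; exact min_le_right _ _)⟩).mono
        (closedBall_subset_closedBall (min_le_right _ _))).weaken (le_max_right _ _)
  · intro u _
    obtain ⟨L, N, hN, h⟩ := hg t₀ x₀ u ht₀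
    obtain ⟨δ, hδ, hball⟩ := Metric.mem_nhds_iff.1 hN
    refine ⟨ball u δ, mem_nhdsWithin_of_mem_nhds (ball_mem_nhds u hδ), δ / 2, half_pos hδ, L,
      fun v hv s hs => LipschitzOnWith.of_dist_le_mul fun y hy z hz => ?_⟩
    have hs' : dist s t₀ < δ := by
      rw [Real.dist_eq, abs_of_nonneg (sub_nonneg.2 hs.1)]
      linarith [hs.2]
    have hmem : ∀ w ∈ closedBall x₀ (δ / 2), (s, w, v) ∈ N := fun w hw => hball (by
      have hw' : dist w x₀ < δ := (mem_closedBall.1 hw).trans_lt (by linarith)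
      simp [Prod.dist_eq, hs', hw', mem_ball.1 hv])
    rw [dist_eq_norm, dist_eq_norm]
    exact h s y z v (ht₀.trans hs.1) (hmem y hy) (hmem z hz)

theorem continuousOn_tube
    (hg : ContinuousOn (fun p : ℝ × EuclideanSpace ℝ (Fin m) × P => g p.1 p.2.1 p.2.2)
      {p | 0 ≤ p.1}) (ht₀ : 0 ≤ t₀) (δ : ℝ) (u : P) :
    ContinuousOn (fun p : ℝ × EuclideanSpace ℝ (Fin m) => g p.1 p.2 u)
      (Icc t₀ (t₀ + δ) ×ˢ closedBall x₀ δ) :=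
  hg.comp (f := fun p : ℝ × EuclideanSpace ℝ (Fin m) => (p.1, p.2, u)) (by fun_prop)
    fun _ hp => ht₀.trans hp.1.1

theorem exists_uniform_bound
    (hg : ContinuousOn (fun p : ℝ × EuclideanSpace ℝ (Fin m) × P => g p.1 p.2.1 p.2.2)
      {p | 0 ≤ p.1}) (hP' : IsCompact P') (ht₀ : 0 ≤ t₀) :
    ∃ δ > 0, ∃ C : ℝ, ∀ u ∈ P', ∀ s ∈ Icc t₀ (t₀ + δ), ∀ x ∈ closedBall x₀ δ,
      ‖g s x u‖ ≤ C := by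
  obtain ⟨δ, hδ, h⟩ := exists_uniform_close (x₀ := x₀) hg hP' ht₀ one_pos
  have hc : ContinuousOn (fun u => g t₀ x₀ u) P' :=
    hg.comp (f := fun u : P => (t₀, x₀, u)) (by fun_prop) fun _ _ => ht₀
  obtain ⟨C, hC⟩ := hP'.exists_bound_of_continuousOn hc
  refine ⟨δ, hδ, 1 + C, fun u hu s hs x hx => ?_⟩
  have := norm_le_norm_sub_add (g s x u) (g t₀ x₀ u)
  linarith [h u hu s hs x hx, hC u hu]

/-- A control chosen for a direction at `(t₀, x₀)` keeps half its guaranteed speed wherever the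
velocity has moved by at most `r / 2`. The constants do not depend on `δ`, which can thus be shrunk
later to control the cost as well. -/
theorem exists_controllableTube {f : ℝ → EuclideanSpace ℝ (Fin m) → P → EuclideanSpace ℝ (Fin m)}
    (hf : ContinuousOn (fun p : ℝ × EuclideanSpace ℝ (Fin m) × P => f p.1 p.2.1 p.2.2)
      {p | 0 ≤ p.1}) (hfL : LocLipschitzInState f) (hP' : IsCompact P') (ht₀ : 0 ≤ t₀)
    (hconv : (0 : EuclideanSpace ℝ (Fin m)) ∈ interior (convexHull ℝ (f t₀ x₀ '' P'))) :
    ∃ δ₀ > 0, ∃ M r : ℝ, ∃ L : ℝ≥0, 0 < r ∧ r ≤ M ∧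
      ∀ δ ≤ δ₀, ControllableTube f P' t₀ x₀ δ M r L := by
  obtain ⟨r, hr, hball⟩ := Metric.nhds_basis_closedBall.mem_iff.1 (mem_interior_iff_mem_nhds.1 hconv)
  obtain ⟨δ₁, hδ₁, hclose⟩ := exists_uniform_close (x₀ := x₀) hf hP' ht₀ (half_pos hr)
  obtain ⟨δ₂, hδ₂, C, hC⟩ := exists_uniform_bound (x₀ := x₀) hf hP' ht₀
  obtain ⟨δ₃, hδ₃, L, hL⟩ := exists_uniform_lipschitz (x₀ := x₀) hfL hP' ht₀
  refine ⟨min δ₁ (min δ₂ δ₃), by positivity, max C (r / 2), r / 2, L, half_pos hr,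
    le_max_right _ _, fun δ hδ => ?_⟩
  have h₁ : δ ≤ δ₁ := hδ.trans (min_le_left _ _)
  have h₂ : δ ≤ δ₂ := hδ.trans ((min_le_right _ _).trans (min_le_left _ _))
  have h₃ : δ ≤ δ₃ := hδ.trans ((min_le_right _ _).trans (min_le_right _ _))
  have hI : ∀ {δ'}, δ ≤ δ' → Icc t₀ (t₀ + δ) ⊆ Icc t₀ (t₀ + δ') := fun h =>
    Icc_subset_Icc_right (by linarith)
  refine ⟨fun u _ => continuousOn_tube hf ht₀ δ u, fun u hu s hs x hx => ?_, fun u hu s hs => ?_,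
    fun d => ?_⟩
  · exact (hC u hu s (hI h₂ hs) x (closedBall_subset_closedBall h₂ hx)).trans (le_max_left _ _)
  · exact (hL u hu s (hI h₃ hs)).mono (closedBall_subset_closedBall h₃)
  · obtain ⟨_, ⟨u, hu, rfl⟩, hd⟩ := exists_mem_mul_norm_le_inner hr.le hball d
    refine ⟨u, hu, fun s hs x hx => ?_⟩
    have h1 := hclose u hu s (hI h₁ hs) x (closedBall_subset_closedBall h₁ hx)
    have h2 := neg_le_of_abs_le (abs_real_inner_le_norm d (f s x u - f t₀ x₀ u))
    have h3 := mul_le_mul_of_nonneg_left h1 (norm_nonneg d)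
    rw [inner_sub_right] at h2
    linarith

/-! ### From dynamic programming to estimates for `S`. -/

/-- Local controllability and the dynamic programming principle bound the increase of `V` between
nearby points at the cost of a small delay. -/
theorem SatisfiesDPP.exists_delayed_bound [MeasurableSpace P]
    {f : ℝ → EuclideanSpace ℝ (Fin m) → P → EuclideanSpace ℝ (Fin m)}
    {f₀ : ℝ → EuclideanSpace ℝ (Fin m) → P → ℝ} {V : ℝ → EuclideanSpace ℝ (Fin m) → ℝ}
    (hV : SatisfiesDPP f f₀ V)
    (hf : ContinuousOn (fun p : ℝ × EuclideanSpace ℝ (Fin m) × P => f p.1 p.2.1 p.2.2)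
      {p | 0 ≤ p.1})
    (hf₀ : ContinuousOn (fun p : ℝ × EuclideanSpace ℝ (Fin m) × P => f₀ p.1 p.2.1 p.2.2)
      {p | 0 ≤ p.1}) (hfL : LocLipschitzInState f) (hP' : IsCompact P') (ht₀ : 0 ≤ t₀)
    (hconv : (0 : EuclideanSpace ℝ (Fin m)) ∈ interior (convexHull ℝ (f t₀ x₀ '' P')))
    {δ₁ : ℝ} (hδ₁ : 0 < δ₁) :
    ∃ K > 0, ∃ C ≥ 0, ∃ ρ > 0, ∀ b ∈ closedBall x₀ ρ, ∀ y ∈ closedBall x₀ ρ, ∃ τ,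
      t₀ ≤ τ ∧ τ ≤ t₀ + K * ‖y - b‖ ∧ τ ≤ t₀ + δ₁ ∧ V t₀ b ≤ C * (τ - t₀) + V τ y := by
  obtain ⟨δ₂, hδ₂, M, r, L, hr, hrM, hT⟩ := exists_controllableTube hf hfL hP' ht₀ hconv
  obtain ⟨δ₃, hδ₃, C, hC⟩ := exists_uniform_bound (x₀ := x₀) hf₀ hP' ht₀
  set δ := min δ₁ (min δ₂ δ₃) with hδ
  have h₁ : δ ≤ δ₁ := min_le_left _ _
  have h₂ : δ ≤ δ₂ := (min_le_right _ _).trans (min_le_left _ _)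
  have h₃ : δ ≤ δ₃ := (min_le_right _ _).trans (min_le_right _ _)
  have hC' : ∀ u ∈ P', ∀ s ∈ Icc t₀ (t₀ + δ), ∀ x ∈ closedBall x₀ δ, ‖f₀ s x u‖ ≤ max C 0 :=
    fun u hu s hs x hx => (hC u hu s (Icc_subset_Icc_right (by linarith) hs) x
      (closedBall_subset_closedBall h₃ hx)).trans (le_max_left _ _)
  obtain ⟨K, hK, ρ, hρ, hsteer⟩ := (hT δ h₂).exists_steering (by positivity) hr hrM
  refine ⟨K, hK, max C 0, le_max_right _ _, ρ, hρ, fun b hb y hy => ?_⟩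
  obtain ⟨τ, u, x, hτ0, hτK, hτδ, hu, huP, hsol, hxτ, hxb, hint⟩ := hsteer b hb y hy
  refine ⟨τ, hτ0, hτK, by linarith, ?_⟩
  have hctrl : IsControl u :=
    ⟨hu.nullMeasurable, fun T => hP'.isBounded.subset (by rintro _ ⟨s, _, rfl⟩; exact huP s)⟩
  -- Only the lower-bound half of the infimum enters: the steering motion is one competitor.
  have hle := (hV t₀ τ b ht₀ hτ0).1 ⟨u, x, hctrl, hsol,
    hint f₀ _ (fun v _ => continuousOn_tube hf₀ ht₀ δ v) hC', rfl⟩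
  have hbd : ‖∫ s in t₀..τ, f₀ s (x s) (u s)‖ ≤ max C 0 * |τ - t₀| :=
    intervalIntegral.norm_integral_le_of_norm_le_const fun s hs => by
      rw [uIoc_of_le hτ0] at hs
      exact hC' _ (huP s) s ⟨hs.1.le, hs.2.trans hτδ⟩ _ (hxb s (Ioc_subset_Icc_self hs))
  rw [abs_of_nonneg (sub_nonneg.2 hτ0)] at hbd
  rw [hxτ] at hle
  linarith [Real.le_norm_self (∫ s in t₀..τ, f₀ s (x s) (u s))]

/-- If the product `R S` increases at most by a multiple of the delay between nearby points, with
`R` positive and Lipschitz in time, then `S` is bounded and Lipschitz near `x₀`. -/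
theorem exists_lipschitz_of_delayed_bound {E : Type*} [NormedAddCommGroup E] {x₀ : E} {S : E → ℝ}
    {R : ℝ → ℝ} {t₀ δ K C Λ ρ : ℝ} (hK : 0 < K) (hC : 0 ≤ C) (hΛ : 0 ≤ Λ) (hρ : 0 < ρ)
    (hR₀ : 0 < R t₀) (hR : ∀ τ ∈ Icc t₀ (t₀ + δ), |R τ - R t₀| ≤ Λ * (τ - t₀))
    (h : ∀ b ∈ closedBall x₀ ρ, ∀ y ∈ closedBall x₀ ρ, ∃ τ,
      t₀ ≤ τ ∧ τ ≤ t₀ + K * ‖y - b‖ ∧ τ ≤ t₀ + δ ∧ R t₀ * S b ≤ C * (τ - t₀) + R τ * S y) :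
    ∃ ρ' > 0, ∃ B ≥ 0, ∃ Λ' ≥ 0, (∀ b ∈ closedBall x₀ ρ', |S b| ≤ B) ∧
      ∀ b ∈ closedBall x₀ ρ', ∀ y ∈ closedBall x₀ ρ', |S b - S y| ≤ Λ' * ‖b - y‖ := by
  -- Chosen so that `R` changes by at most `R t₀ / 2` during the delay; the `+ 1` covers `Λ = 0`.
  set ρ' := min ρ (R t₀ / (2 * (Λ * K + 1))) with hρ'
  have hpos : 0 < ρ' := by positivity
  have hρρ : ρ' ≤ ρ := min_le_left _ _
  have hsmall : Λ * (K * ρ') ≤ R t₀ / 2 := by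
    have h1 : ρ' ≤ R t₀ / (2 * (Λ * K + 1)) := min_le_right _ _
    rw [le_div_iff₀ (by positivity)] at h1
    nlinarith
  have hx₀ : x₀ ∈ closedBall x₀ ρ := mem_closedBall_self hρ.le
  set A := C * (K * ρ') + 2 * R t₀ * |S x₀| with hA
  have hA0 : 0 ≤ A := by positivity
  -- The factor `2` pays for `R τ ≥ R t₀ / 2` in the lower bound for `S`.
  set B := 2 * A / R t₀ with hB
  have hB0 : 0 ≤ B := by positivity
  have hBA : R t₀ * B = 2 * A := by rw [hB]; field_simp
  have hSx := abs_le.1 (le_refl |S x₀|)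
  have hτ : ∀ {τ d}, t₀ ≤ τ → τ ≤ t₀ + K * d → τ ≤ t₀ + δ → d ≤ ρ' →
      C * (τ - t₀) ≤ C * (K * ρ') ∧ R t₀ / 2 ≤ R τ ∧ R τ ≤ 2 * R t₀ := by
    intro τ d h0 h1 h2 hd
    have h3 : τ - t₀ ≤ K * ρ' := by have := mul_le_mul_of_nonneg_left hd hK.le; linarith
    have h4 := abs_le.1 ((hR τ ⟨h0, h2⟩).trans (mul_le_mul_of_nonneg_left h3 hΛ))
    exact ⟨mul_le_mul_of_nonneg_left h3 hC, by linarith, by linarith⟩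
  have hSB : ∀ b ∈ closedBall x₀ ρ', |S b| ≤ B := by
    intro b hb
    have hb' := closedBall_subset_closedBall hρρ hb
    rw [mem_closedBall, dist_eq_norm] at hb
    rw [abs_le]
    constructor
    · obtain ⟨τ, h0, h1, h2, h3⟩ := h x₀ hx₀ b hb'
      obtain ⟨h4, h5, h6⟩ := hτ h0 h1 h2 hb
      by_contra! hlt
      have : R τ * S b ≤ R t₀ / 2 * S b := mul_le_mul_of_nonpos_right h5 (by linarith)
      have := mul_lt_mul_of_pos_left hlt hR₀
      have := mul_le_mul_of_nonneg_left hSx.1 hR₀.le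
      have := mul_nonneg hR₀.le (abs_nonneg (S x₀))
      linarith
    · obtain ⟨τ, h0, h1, h2, h3⟩ := h b hb' x₀ hx₀
      rw [norm_sub_rev] at h1
      obtain ⟨h4, h5, h6⟩ := hτ h0 h1 h2 hb
      have h7 : R τ * S x₀ ≤ 2 * R t₀ * |S x₀| :=
        (mul_le_mul_of_nonneg_left hSx.2 (by linarith)).trans
          (mul_le_mul_of_nonneg_right h6 (abs_nonneg _))
      refine le_of_mul_le_mul_left ?_ hR₀
      linarith
  have hone : ∀ b ∈ closedBall x₀ ρ', ∀ y ∈ closedBall x₀ ρ',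
      S b - S y ≤ (C + Λ * B) * K / R t₀ * ‖b - y‖ := by
    intro b hb y hy
    obtain ⟨τ, h0, h1, h2, h3⟩ := h b (closedBall_subset_closedBall hρρ hb) y
      (closedBall_subset_closedBall hρρ hy)
    -- The delay error, now controlled because `S` is already bounded.
    have h4 : (R τ - R t₀) * S y ≤ Λ * (τ - t₀) * B := by
      refine (le_abs_self _).trans ?_
      rw [abs_mul]
      exact mul_le_mul (hR τ ⟨h0, h2⟩) (hSB y hy) (abs_nonneg _)
        (mul_nonneg hΛ (sub_nonneg.2 h0))
    have h5 : (C + Λ * B) * (τ - t₀) ≤ (C + Λ * B) * (K * ‖b - y‖) := by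
      refine mul_le_mul_of_nonneg_left ?_ (by positivity)
      rw [norm_sub_rev b y]
      linarith
    rw [div_mul_eq_mul_div, le_div_iff₀ hR₀]
    linarith
  refine ⟨ρ', hpos, B, hB0, (C + Λ * B) * K / R t₀, by positivity, hSB, fun b hb y hy => ?_⟩
  rw [abs_le]
  constructor
  · have := hone y hy b hb
    rw [norm_sub_rev] at this
    linarith
  · exact hone b hb y hy

end InfHorizon

/-! ### The joint Lipschitz estimate for `V`. -/

theorem corollary6p1 {m : ℕ} {P : Type*} [MetricSpace P] [CompleteSpace P]
    [TopologicalSpace.SeparableSpace P] [MeasurableSpace P] [BorelSpace P]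
    (f : ℝ → EuclideanSpace ℝ (Fin m) → P → EuclideanSpace ℝ (Fin m))
    (f₀ : ℝ → EuclideanSpace ℝ (Fin m) → P → ℝ)
    (hf : ContinuousOn (fun p : ℝ × EuclideanSpace ℝ (Fin m) × P => f p.1 p.2.1 p.2.2)
      {p | 0 ≤ p.1})
    (hf₀ : ContinuousOn (fun p : ℝ × EuclideanSpace ℝ (Fin m) × P => f₀ p.1 p.2.1 p.2.2)
      {p | 0 ≤ p.1})
    (hfL : InfHorizon.LocLipschitzInState f)
    (hf₀L : InfHorizon.LocLipschitzInState f₀)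
    (hgrowth : InfHorizon.SublinearGrowth f)
    (V : ℝ → EuclideanSpace ℝ (Fin m) → ℝ)
    (hV : InfHorizon.SatisfiesDPP f f₀ V)
    (P' : Set P) (hP' : IsCompact P')
    (G : Set (ℝ × EuclideanSpace ℝ (Fin m)))
    (hG : ∃ O : Set (ℝ × EuclideanSpace ℝ (Fin m)), IsOpen O ∧ G = O ∩ {p | 0 ≤ p.1})
    (hconv : ∀ t x, (t, x) ∈ G →
      (0 : EuclideanSpace ℝ (Fin m)) ∈ interior (convexHull ℝ (f t x '' P')))
    (S : EuclideanSpace ℝ (Fin m) → ℝ) (R : ℝ → ℝ)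
    (hRpos : ∀ p ∈ G, 0 < R p.1)
    (hRL : LocallyLipschitzOn G (fun p : ℝ × EuclideanSpace ℝ (Fin m) => R p.1))
    (hVRS : ∀ t x, (t, x) ∈ G → V t x = R t * S x) :
    LocallyLipschitzOn G (fun p : ℝ × EuclideanSpace ℝ (Fin m) => V p.1 p.2) := by
  obtain ⟨O, hO, rfl⟩ := hG
  rintro ⟨t₀, x₀⟩ hp
  have ht₀ : 0 ≤ t₀ := hp.2
  obtain ⟨Λ, T, hT, hRT⟩ := hRL hp
  obtain ⟨N, hN, hNT⟩ := mem_nhdsWithin_iff_exists_mem_nhds_inter.1 hT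
  obtain ⟨δ, hδ, hball⟩ := Metric.nhds_basis_closedBall.mem_iff.1
    (Filter.inter_mem hN (hO.mem_nhds hp.1))
  have hmem : ∀ {s x}, 0 ≤ s → dist s t₀ ≤ δ → dist x x₀ ≤ δ →
      (s, x) ∈ O ∩ {p : ℝ × EuclideanSpace ℝ (Fin m) | 0 ≤ p.1} ∧ (s, x) ∈ T := by
    intro s x h0 hs hx
    have h : (s, x) ∈ N ∩ O := hball (by simp [Prod.dist_eq, hs, hx])
    exact ⟨⟨h.2, h0⟩, hNT ⟨h.1, h.2, h0⟩⟩
  have hself : dist t₀ t₀ ≤ δ := by simpa using hδ.le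
  have hselfx : dist x₀ x₀ ≤ δ := by simpa using hδ.le
  have hlate : ∀ τ ∈ Icc t₀ (t₀ + δ), dist τ t₀ ≤ δ := fun τ hτ => by
    rw [Real.dist_eq, abs_of_nonneg (sub_nonneg.2 hτ.1)]
    linarith [hτ.2]
  -- Motions starting at the single time `t₀` suffice: the resulting estimates for `S` hold at all
  -- nearby times, earlier ones included, since `S` does not depend on time.
  obtain ⟨K, hK, C, hC, ρ, hρ, hbound⟩ := hV.exists_delayed_bound hf hf₀ hfL hP' ht₀
    (hconv t₀ x₀ hp) hδ
  obtain ⟨ρ', hρ', B, hB, Λ', hΛ', hSB, hSL⟩ :=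
    InfHorizon.exists_lipschitz_of_delayed_bound (x₀ := x₀) (S := S) (R := R) (t₀ := t₀) (δ := δ)
      (Λ := Λ) (ρ := min ρ δ) hK hC Λ.coe_nonneg (lt_min hρ hδ) (hRpos _ hp)
      (fun τ hτ => by
        have := hRT.dist_le_mul (τ, x₀) (hmem (ht₀.trans hτ.1) (hlate τ hτ) hselfx).2 (t₀, x₀)
          (hmem ht₀ hself hselfx).2
        simpa [Prod.dist_eq, Real.dist_eq, abs_of_nonneg (sub_nonneg.2 hτ.1), hτ.1] using this)
      fun b hb y hy => by
        obtain ⟨τ, h0, h1, h2, h3⟩ := hbound b (Metric.closedBall_subset_closedBall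
          (min_le_left _ _) hb) y (Metric.closedBall_subset_closedBall (min_le_left _ _) hy)
        refine ⟨τ, h0, h1, h2, ?_⟩
        rwa [hVRS t₀ b (hmem ht₀ hself (hb.trans (min_le_right _ _))).1,
          hVRS τ y (hmem (ht₀.trans h0) (hlate τ ⟨h0, h2⟩) (hy.trans (min_le_right _ _))).1] at h3
  have hcyl : ∀ p ∈ Metric.closedBall (t₀, x₀) (min δ ρ') ∩
      (O ∩ {p : ℝ × EuclideanSpace ℝ (Fin m) | 0 ≤ p.1}),
      p ∈ T ∧ p.2 ∈ Metric.closedBall x₀ ρ' ∧ |R p.1| ≤ R t₀ + Λ * δ := by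
    rintro ⟨s, x⟩ ⟨hsx, hG⟩
    rw [Metric.mem_closedBall, Prod.dist_eq, max_le_iff, le_min_iff, le_min_iff] at hsx
    have hsT := hmem hG.2 hsx.1.1 hsx.2.1
    refine ⟨hsT.2, hsx.2.2, ?_⟩
    have h1 := hRT.dist_le_mul (s, x) hsT.2 (t₀, x₀) (hmem ht₀ hself hselfx).2
    have h2 : dist (s, x) (t₀, x₀) ≤ δ := max_le hsx.1.1 hsx.2.1
    have h3 := mul_le_mul_of_nonneg_left h2 Λ.coe_nonneg
    rw [abs_of_pos (hRpos _ hG)]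
    have h4 := (le_abs_self (R s - R t₀)).trans h1
    simp only at h3 h4 ⊢
    linarith
  have hM : 0 ≤ R t₀ + Λ * δ := add_nonneg (hRpos _ hp).le (mul_nonneg Λ.coe_nonneg hδ.le)
  refine ⟨⟨Λ * B + (R t₀ + Λ * δ) * Λ', by positivity⟩,
    Metric.closedBall (t₀, x₀) (min δ ρ') ∩ (O ∩ {p | 0 ≤ p.1}),
    Filter.inter_mem (mem_nhdsWithin_of_mem_nhds
      (Metric.closedBall_mem_nhds _ (lt_min hδ hρ'))) self_mem_nhdsWithin,
    LipschitzOnWith.of_dist_le_mul ?_⟩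
  rintro ⟨s, x⟩ hs ⟨s', x'⟩ hs'
  obtain ⟨h1, h2, h3⟩ := hcyl _ hs
  obtain ⟨h1', h2', h3'⟩ := hcyl _ hs'
  change dist (V s x) (V s' x') ≤ (Λ * B + (R t₀ + Λ * δ) * Λ') * dist (s, x) (s', x')
  rw [hVRS s x hs.2, hVRS s' x' hs'.2, Real.dist_eq]
  have hR := hRT.dist_le_mul _ h1 _ h1'
  have hS := hSL x h2 x' h2'
  have hd : ‖x - x'‖ ≤ dist (s, x) (s', x') := by
    rw [← dist_eq_norm]; exact le_max_right _ _
  have e : R s * S x - R s' * S x' = (R s - R s') * S x + R s' * (S x - S x') := by ring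
  rw [e, add_mul]
  refine (abs_add_le _ _).trans ?_
  rw [abs_mul, abs_mul]
  refine add_le_add ?_ ?_
  · exact (mul_le_mul hR (hSB x h2) (abs_nonneg _) (by positivity)).trans_eq (by ring)
  · refine (mul_le_mul h3' (hS.trans (mul_le_mul_of_nonneg_left hd hΛ')) (abs_nonneg _)
      hM).trans_eq (by ring)
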